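/- Let $G$ be a connected complex linear algebraic group (a Zariski closed, Zariski connected subgroup of some $\mathrm{GL}_m(\mathbb C)$), let $V$ be a finite-dimensional complex vector space, and let $\rho:G\to \mathrm{GL}(V)$ be a rational representation such that $G$ has a Zariski open orbit $\Omega$ in $V$ (so $(G,\rho,V)$ is a prehomogeneous vector space). A nonzero rational function $f$ on $V$ is a \emph{relative invariant} with rational character $\chi:G\to\mathbb C^*$ if $f(\rho(g)(v))=\chi(g)f(v)$ for all $v\in\Omega$, $g\in G$ (in particular $f$ has no poles on $\Omega$); we write $f\leftrightarrow\chi$. A rational function $h$ on $V$ is an \emph{additive relative invariant} if there is a homomorphism of algebraic groups $\Phi:G\to(\mathbb C,+)$ such that $h(\rho(g)(v))-h(v)=\Phi(g)$ for all $v\in\Omega$, $g\in G$ (in particular $h$ has no poles on $\Omega$). For polynomials $p,q,f$ on $V$ with $f$ irreducible, $p$ and $q$ \emph{agree to order $k$ on $V(f)$} if $p-q\in (f)^{k+1}$, an ideal power in $\mathbb C[V]$. Let $f_1,\dots,f_r$ be the basic relative invariants of $(G,\rho,V)$, i.e. irreducible polynomials whose zero sets are the distinct irreducible hypersurface components of $V\setminus\Omega$,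 with $f_i\leftrightarrow\chi_i$. Let $h=h_1/f$, where $h_1,f$ are homogeneous polynomials on $V$ of the same degree with no common factors, and $f=f_1^{k_1}\cdots f_r^{k_r}$ with integers $k_i\ge 0$. Let $\chi=\chi_1^{k_1}\cdots\chi_r^{k_r}$. Then the following are equivalent: \begin{enumerate} \item $h$ is an additive relative invariant. \item For all $i$ with $k_i>0$ and all $g\in G$, the polynomials $h_1\circ\rho(g)$ and $\chi(g)\,h_1$ agree to order $k_i-1$ on $V(f_i)$. \item For all $g\in G$, the polynomial $h_1\circ\rho(g)-\chi(g)\,h_1\in\mathbb C[V]$ is divisible by $f$. \end{enumerate} Moreover, if $f$ is reduced (squarefree) and $V_\epsilon=\{x\in V: f(x)=h_1(x)-\epsilon=0\}$ for $\epsilon\in\mathbb C$, then $h$ is an additive relative invariant if and only if $\rho(g)(V_\epsilon)=V_{\chi(g)\epsilon}$ for all $g\in G$ and all $\epsilon\in\mathbb C$. -/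

import Mathlib

open scoped Topology

noncomputable section

namespace PVS

/-- The Zariski topology on a set `X` defined by a family `A` of (regular) functions `X → ℂ`: the
topology generated by the nonvanishing loci of the members of `A`. -/
abbrev zariskiTopology {X : Type*} (A : Set (X → ℂ)) : TopologicalSpace X :=
  TopologicalSpace.generateFrom {U | ∃ φ ∈ A, U = {x | φ x ≠ 0}}

section Group

/-- The coordinate ring of `GL_m(ℂ)`, as an algebra of functions: it is generated by the matrix
entries and the inverse of the determinant. -/
def coordGL (m : ℕ) : Subalgebra ℂ (GL (Fin m) ℂ → ℂ) :=
  Algebra.adjoin ℂ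
    ({φ | ∃ i j : Fin m, φ = fun g : GL (Fin m) ℂ => (g : Matrix (Fin m) (Fin m) ℂ) i j} ∪
      {fun g : GL (Fin m) ℂ => ((g : Matrix (Fin m) (Fin m) ℂ).det)⁻¹})

/-- The Zariski topology of `GL_m(ℂ)`. -/
abbrev zariskiGL (m : ℕ) : TopologicalSpace (GL (Fin m) ℂ) :=
  zariskiTopology (coordGL m : Set (GL (Fin m) ℂ → ℂ))

variable {m : ℕ}

/-- `G` is a connected complex linear algebraic group: a Zariski closed subgroup of `GL_m(ℂ)` that
is connected in the Zariski topology. -/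
structure IsConnectedLinearAlgebraicGroup (G : Subgroup (GL (Fin m) ℂ)) : Prop where
  isClosed : IsClosed[zariskiGL m] (G : Set (GL (Fin m) ℂ))
  isConnected : @IsConnected _ (zariskiGL m) (G : Set (GL (Fin m) ℂ))

variable {G : Subgroup (GL (Fin m) ℂ)}

/-- Regular functions on `G`: restrictions of regular functions on `GL_m(ℂ)`. -/
def IsRegular (φ : G → ℂ) : Prop :=
  ∃ ψ ∈ coordGL m, ∀ g : G, φ g = ψ g

/-- `χ` belongs to `X(G)`: it is a rational (multiplicative) character, that is, a homomorphism
`G → 𝔾ₘ` of algebraic groups. -/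
def IsRationalCharacter (χ : G →* ℂˣ) : Prop :=
  IsRegular fun g => (χ g : ℂ)

/-- `Φ` belongs to `𝒜(G)`: it is an additive function of `G`, that is, a homomorphism `G → 𝔾ₐ` of
algebraic groups. -/
structure IsAdditiveFunction (Φ : G → ℂ) : Prop where
  map_mul : ∀ g g' : G, Φ (g * g') = Φ g + Φ g'
  isRegular : IsRegular Φ

end Group

section Space

variable {n : ℕ} {V : Type*} [AddCommGroup V] [Module ℂ V]

/-! The coordinate ring `ℂ[V]` is the polynomial ring in the coordinates of a basis `b` of `V`. -/

/-- The value of a polynomial `p ∈ ℂ[V]` at a vector `v`. -/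
def polyEval (b : Module.Basis (Fin n) ℂ V) (p : MvPolynomial (Fin n) ℂ) (v : V) : ℂ :=
  MvPolynomial.eval (b.repr v) p

/-- The polynomial `p ∘ T` for `p ∈ ℂ[V]` and a linear endomorphism `T` of `V`. -/
def polyComp (b : Module.Basis (Fin n) ℂ V) (p : MvPolynomial (Fin n) ℂ) (T : V →ₗ[ℂ] V) :
    MvPolynomial (Fin n) ℂ :=
  MvPolynomial.bind₁ (LinearMap.toMvPolynomial b b T) p

theorem polyEval_polyComp (b : Module.Basis (Fin n) ℂ V) (p : MvPolynomial (Fin n) ℂ)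
    (T : V →ₗ[ℂ] V) (v : V) : polyEval b (polyComp b p T) v = polyEval b p (T v) := by
  have key : (MvPolynomial.eval (b.repr v)).comp
      (MvPolynomial.bind₁ (LinearMap.toMvPolynomial b b T)).toRingHom =
      MvPolynomial.eval (b.repr (T v)) := by
    apply MvPolynomial.ringHom_ext
    · intro c
      simp
    · intro i
      simp [LinearMap.toMvPolynomial_eval_eq_apply]
  exact DFunLike.congr_fun key p

/-- The hypersurface `V(p)`, i.e. the set of zeros of `p` in `V`. -/
def zeroSet (b : Module.Basis (Fin n) ℂ V) (p : MvPolynomial (Fin n) ℂ) : Set V :=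
  {v | polyEval b p v = 0}

/-- The Zariski topology of the vector space `V`. -/
abbrev zariskiSpace (b : Module.Basis (Fin n) ℂ V) : TopologicalSpace V :=
  zariskiTopology (Set.range (polyEval b))

/-- `p` and `q` agree to order `k` on `V(f)`. -/
def AgreeToOrder (k : ℕ) (f p q : MvPolynomial (Fin n) ℂ) : Prop :=
  p - q ∈ Ideal.span {f} ^ (k + 1)

/-- The rational functions on `V`. -/
abbrev RatFun (n : ℕ) : Type := FractionRing (MvPolynomial (Fin n) ℂ)

/-- The rational function `p / q`. -/
def ratMk (p q : MvPolynomial (Fin n) ℂ) : RatFun n :=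
  algebraMap (MvPolynomial (Fin n) ℂ) (RatFun n) p / algebraMap (MvPolynomial (Fin n) ℂ) (RatFun n) q

/-- The rational function `h` is defined (has no pole) at `v`, and its value there is `c`. -/
def HasValueAt (b : Module.Basis (Fin n) ℂ V) (h : RatFun n) (v : V) (c : ℂ) : Prop :=
  ∃ p q : MvPolynomial (Fin n) ℂ,
    polyEval b q v ≠ 0 ∧ h = ratMk p q ∧ c = polyEval b p v / polyEval b q v

theorem HasValueAt.unique {b : Module.Basis (Fin n) ℂ V} {h : RatFun n} {v : V} {c c' : ℂ}
    (hc : HasValueAt b h v c) (hc' : HasValueAt b h v c') : c = c' := by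
  obtain ⟨p, q, hq, e, rfl⟩ := hc
  obtain ⟨p', q', hq', e', rfl⟩ := hc'
  have inj := IsFractionRing.injective (MvPolynomial (Fin n) ℂ) (RatFun n)
  have q0 : algebraMap _ (RatFun n) q ≠ 0 := by
    rw [Ne, map_eq_zero_iff _ inj]; rintro rfl; simp [polyEval] at hq
  have q0' : algebraMap _ (RatFun n) q' ≠ 0 := by
    rw [Ne, map_eq_zero_iff _ inj]; rintro rfl; simp [polyEval] at hq'
  rw [e, ratMk, ratMk, div_eq_div_iff q0 q0', ← map_mul, ← map_mul] at e'
  have e2 := congrArg (MvPolynomial.eval (b.repr v)) (inj e')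
  rw [map_mul, map_mul] at e2
  rw [div_eq_div_iff hq hq']
  exact e2

end Space

section Prehomogeneous

variable {m n : ℕ} {G : Subgroup (GL (Fin m) ℂ)} {V : Type*} [AddCommGroup V] [Module ℂ V]

/-- `ρ` is a rational representation, that is, a homomorphism `G → GL(V)` of algebraic groups:
its matrix coefficients are regular functions on `G`. -/
def IsRationalRepresentation (ρ : Representation ℂ G V) : Prop :=
  ∀ (v : V) (l : Module.Dual ℂ V), IsRegular fun g : G => l (ρ g v)

/-- `(G, ρ, V)` is a prehomogeneous vector space with open orbit `Ω`. -/
structure IsPrehomogeneous (b : Module.Basis (Fin n) ℂ V) (ρ : Representation ℂ G V)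
    (Ω : Set V) : Prop where
  group : IsConnectedLinearAlgebraicGroup G
  rational : IsRationalRepresentation ρ
  isOrbit : ∃ v₀ : V, Ω = Set.range fun g : G => ρ g v₀
  isOpen : IsOpen[zariskiSpace b] Ω

/-- `S` is an irreducible component of the exceptional orbit variety `V ∖ Ω`, and it is a
hypersurface. -/
def IsHypersurfaceComponent (b : Module.Basis (Fin n) ℂ V) (Ω S : Set V) : Prop :=
  Maximal (fun T : Set V => @IsIrreducible V (zariskiSpace b) T ∧ T ⊆ Ωᶜ) S ∧
    ∃ p : MvPolynomial (Fin n) ℂ, p.totalDegree ≠ 0 ∧ S = zeroSet b p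

/-- The rational function `f` is a relative invariant with character `χ`: `f` is not identically
zero, and `f(ρ(g)(v)) = χ(g) f(v)` for all `v ∈ Ω` and `g ∈ G`. -/
structure IsRelativeInvariantFor (b : Module.Basis (Fin n) ℂ V) (ρ : Representation ℂ G V)
    (Ω : Set V) (f : RatFun n) (χ : G →* ℂˣ) : Prop where
  ne_zero : f ≠ 0
  character : IsRationalCharacter χ
  equation : ∀ g : G, ∀ v ∈ Ω, ∃ c : ℂ, HasValueAt b f v c ∧ HasValueAt b f (ρ g v) (χ g * c)

/-- `f 0, …, f (r - 1)` are the basic relative invariants: irreducible polynomials whose zero sets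
are the distinct irreducible hypersurface components of `V ∖ Ω`. -/
structure AreBasicRelativeInvariants (b : Module.Basis (Fin n) ℂ V) (Ω : Set V) {r : ℕ}
    (f : Fin r → MvPolynomial (Fin n) ℂ) : Prop where
  irreducible : ∀ i, Irreducible (f i)
  injective : Function.Injective fun i => zeroSet b (f i)
  range_eq : (Set.range fun i => zeroSet b (f i)) = {S | IsHypersurfaceComponent b Ω S}

/-- The rational function `h` is an additive relative invariant: for some additive function `Φ`
of `G`, `h(ρ(g)(v)) - h(v) = Φ(g)` for all `v ∈ Ω` and `g ∈ G`. -/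
def IsAdditiveRelativeInvariant (b : Module.Basis (Fin n) ℂ V) (ρ : Representation ℂ G V)
    (Ω : Set V) (h : RatFun n) : Prop :=
  ∃ Φ : G → ℂ, IsAdditiveFunction Φ ∧
    ∀ g : G, ∀ v ∈ Ω, ∃ a c : ℂ, HasValueAt b h (ρ g v) a ∧ HasValueAt b h v c ∧ a - c = Φ g

/-- The set `V_ε = {x | f(x) = h₁(x) - ε = 0}`. -/
def levelSet (b : Module.Basis (Fin n) ℂ V) (f h₁ : MvPolynomial (Fin n) ℂ) (ε : ℂ) : Set V :=
  {x | polyEval b f x = 0 ∧ polyEval b h₁ x - ε = 0}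

end Prehomogeneous

end PVS

end

/-!
Write `F = ∏ fᵢ ^ kᵢ`. On `Ω` the polynomial `F` does not vanish and `F ∘ ρ(g) = χ(g) F`, so there
`χ(g) F (h ∘ ρ(g) - h)` is the defect `h₁ ∘ ρ(g) - χ(g) h₁`. As `Ω` is a Zariski dense orbit, `h` is
an additive relative invariant exactly when each defect is a constant multiple of `F`: the resulting
`Φ` is additive by telescoping, and regular because it can be computed at one point of `Ω`. Defect
and `F` being homogeneous of the same degree, "constant multiple" means "multiple". Divisibility by
`F` splits into divisibility by the pairwise coprime `fᵢ ^ kᵢ`. Finally, `ρ(g)` maps each `V_ε` into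
`V_{χ(g) ε}` exactly when the defect vanishes on `V(F)`, which for squarefree `F` is divisibility by
the Nullstellensatz.
-/

namespace PVS

section Pullback

variable {R X Y : Type*} [CommSemiring R]

/-- Precomposition with a map `e : X → Y`, as a homomorphism between algebras of functions. -/
def pullback (e : X → Y) : (Y → R) →ₐ[R] (X → R) :=
  AlgHom.pi fun x => Pi.evalAlgHom R (fun _ => R) (e x)

@[simp]
theorem pullback_apply (e : X → Y) (φ : Y → R) (x : X) : pullback e φ x = φ (e x) :=
  rfl

end Pullback

section MatrixEntries

variable {ι S σ : Type*} [Fintype ι] [DecidableEq ι] [CommRing S] [SetLike σ S] [SubringClass σ S]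
  {s : σ} {M : Matrix ι ι S}

theorem det_mem_of_forall_mem (hM : ∀ i j, M i j ∈ s) : M.det ∈ s := by
  rw [Matrix.det_apply']
  exact sum_mem fun τ _ => mul_mem (intCast_mem s _) (prod_mem fun i _ => hM (τ i) i)

theorem adjugate_mem_of_forall_mem (hM : ∀ i j, M i j ∈ s) (i j : ι) : M.adjugate i j ∈ s := by
  rw [Matrix.adjugate_apply]
  refine det_mem_of_forall_mem fun k l => ?_
  rw [Matrix.updateRow_apply, Pi.single_apply]
  split_ifs
  exacts [one_mem s, zero_mem s, hM k l]

end MatrixEntries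

section Group

variable {m : ℕ}

/-- The generic invertible matrix: its entries are the coordinate functions on `GL_m(ℂ)`. -/
def genericMatrix (m : ℕ) : Matrix (Fin m) (Fin m) (GL (Fin m) ℂ → ℂ) :=
  Matrix.of fun i j g => (g : Matrix (Fin m) (Fin m) ℂ) i j

theorem det_genericMatrix_apply (g : GL (Fin m) ℂ) :
    (genericMatrix m).det g = (g : Matrix (Fin m) (Fin m) ℂ).det :=
  RingHom.map_det (Pi.evalRingHom (fun _ => ℂ) g) (genericMatrix m)

theorem adjugate_genericMatrix_apply (i j : Fin m) (g : GL (Fin m) ℂ) :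
    (genericMatrix m).adjugate i j g = (g : Matrix (Fin m) (Fin m) ℂ).adjugate i j :=
  congrFun₂ (RingHom.map_adjugate (Pi.evalRingHom (fun _ => ℂ) g) (genericMatrix m)) i j

theorem genericMatrix_mem_coordGL (i j : Fin m) : genericMatrix m i j ∈ coordGL m :=
  Algebra.subset_adjoin (Or.inl ⟨i, j, rfl⟩)

theorem det_inv_mem_coordGL :
    (fun g : GL (Fin m) ℂ => ((g : Matrix (Fin m) (Fin m) ℂ).det)⁻¹) ∈ coordGL m :=
  Algebra.subset_adjoin (Or.inr rfl)

theorem pullback_inv_genericMatrix (i j : Fin m) :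
    pullback Inv.inv (genericMatrix m i j) =
      (fun g : GL (Fin m) ℂ => ((g : Matrix (Fin m) (Fin m) ℂ).det)⁻¹) *
        (genericMatrix m).adjugate i j := by
  funext g
  rw [Pi.mul_apply, adjugate_genericMatrix_apply]
  simp [genericMatrix, Matrix.coe_units_inv, Matrix.inv_def]

theorem pullback_inv_det_inv :
    pullback Inv.inv (fun g : GL (Fin m) ℂ => ((g : Matrix (Fin m) (Fin m) ℂ).det)⁻¹) =
      (genericMatrix m).det := by
  funext g
  simp [det_genericMatrix_apply, Matrix.coe_units_inv, Matrix.det_nonsing_inv]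

theorem coordGL_le_comap_pullback_inv : coordGL m ≤ (coordGL m).comap (pullback Inv.inv) := by
  refine Algebra.adjoin_le ?_
  rintro _ (⟨i, j, rfl⟩ | rfl)
  · change pullback Inv.inv (genericMatrix m i j) ∈ coordGL m
    rw [pullback_inv_genericMatrix]
    exact mul_mem det_inv_mem_coordGL (adjugate_mem_of_forall_mem genericMatrix_mem_coordGL i j)
  · change pullback Inv.inv _ ∈ coordGL m
    rw [pullback_inv_det_inv]
    exact det_mem_of_forall_mem genericMatrix_mem_coordGL

/-- The algebra of regular functions on a subgroup `G` of `GL_m(ℂ)`; membership in it is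
`IsRegular` (see `mem_regularFunctions`). -/
def regularFunctions (G : Subgroup (GL (Fin m) ℂ)) : Subalgebra ℂ (G → ℂ) :=
  (coordGL m).map (pullback Subtype.val)

variable {G : Subgroup (GL (Fin m) ℂ)}

theorem mem_regularFunctions {φ : G → ℂ} : φ ∈ regularFunctions G ↔ IsRegular φ :=
  exists_congr fun _ => and_congr_right fun _ => eq_comm.trans funext_iff

theorem isRegular_const (c : ℂ) : IsRegular fun _ : G => c :=
  mem_regularFunctions.1 ((regularFunctions G).algebraMap_mem c)

theorem IsRegular.add {φ ψ : G → ℂ} (hφ : IsRegular φ) (hψ : IsRegular ψ) :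
    IsRegular fun g => φ g + ψ g :=
  mem_regularFunctions.1 (add_mem (mem_regularFunctions.2 hφ) (mem_regularFunctions.2 hψ))

theorem IsRegular.sub {φ ψ : G → ℂ} (hφ : IsRegular φ) (hψ : IsRegular ψ) :
    IsRegular fun g => φ g - ψ g :=
  mem_regularFunctions.1 (sub_mem (mem_regularFunctions.2 hφ) (mem_regularFunctions.2 hψ))

theorem IsRegular.mul {φ ψ : G → ℂ} (hφ : IsRegular φ) (hψ : IsRegular ψ) :
    IsRegular fun g => φ g * ψ g :=
  mem_regularFunctions.1 (mul_mem (mem_regularFunctions.2 hφ) (mem_regularFunctions.2 hψ))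

theorem IsRegular.comp_inv {φ : G → ℂ} (hφ : IsRegular φ) : IsRegular fun g => φ g⁻¹ := by
  obtain ⟨ψ, hψ, hφψ⟩ := hφ
  exact ⟨_, coordGL_le_comap_pullback_inv hψ, fun g => hφψ g⁻¹⟩

theorem IsRationalCharacter.isRegular_inv {χ : G →* ℂˣ} (hχ : IsRationalCharacter χ) :
    IsRegular fun g => (χ g : ℂ)⁻¹ := by
  simpa only [map_inv, Units.val_inv_eq_inv_val] using IsRegular.comp_inv hχ

end Group

section Divisibility

theorem prod_pow_dvd_iff {ι R : Type*} [CommMonoid R] [DecompositionMonoid R] {s : Finset ι}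
    {f : ι → R} (hf : (s : Set ι).Pairwise (Function.onFun IsRelPrime f)) (k : ι → ℕ) (q : R) :
    ∏ i ∈ s, f i ^ k i ∣ q ↔ ∀ i ∈ s, f i ^ k i ∣ q :=
  ⟨fun h _ hi => (Finset.dvd_prod_of_mem _ hi).trans h,
    Finset.prod_dvd_of_isRelPrime fun _ hi _ hj hij => (hf hi hj hij).pow⟩

theorem dvd_iff_exists_eq_C_mul {σ R : Type*} [CommRing R] [IsDomain R] {p q : MvPolynomial σ R}
    {d : ℕ} (hp : p.IsHomogeneous d) (hq : q.IsHomogeneous d) :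
    p ∣ q ↔ ∃ c : R, q = MvPolynomial.C c * p := by
  refine ⟨?_, fun ⟨c, hc⟩ => hc ▸ dvd_mul_left p _⟩
  rintro ⟨s, rfl⟩
  obtain h0 | h0 := eq_or_ne (p * s) 0
  · exact ⟨0, by rw [h0, map_zero, zero_mul]⟩
  have hp0 : p ≠ 0 := left_ne_zero_of_mul h0
  have hdeg : p.totalDegree + s.totalDegree = p.totalDegree := by
    rw [← MvPolynomial.totalDegree_mul_of_isDomain hp0 (right_ne_zero_of_mul h0),
      hq.totalDegree h0, hp.totalDegree hp0]
  have hs : s = MvPolynomial.C (s.coeff 0) :=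
    MvPolynomial.totalDegree_eq_zero_iff_eq_C.1 (Nat.add_eq_left.1 hdeg)
  exact ⟨s.coeff 0, by rw [← hs, mul_comm]⟩

variable {n : ℕ}

theorem agreeToOrder_sub_one_iff {k : ℕ} (hk : 0 < k) {f p q : MvPolynomial (Fin n) ℂ} :
    AgreeToOrder (k - 1) f p q ↔ f ^ k ∣ p - q := by
  rw [AgreeToOrder, Nat.sub_add_cancel hk, Ideal.span_singleton_pow, Ideal.mem_span_singleton]

theorem forall_agreeToOrder_sub_one_iff {ι : Type*} [Fintype ι] {f : ι → MvPolynomial (Fin n) ℂ}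
    (hf : Pairwise (Function.onFun IsRelPrime f)) (k : ι → ℕ) (p q : MvPolynomial (Fin n) ℂ) :
    (∀ i, 0 < k i → AgreeToOrder (k i - 1) (f i) p q) ↔ ∏ i, f i ^ k i ∣ p - q := by
  rw [prod_pow_dvd_iff (hf.set_pairwise _)]
  refine forall_congr' fun i => ?_
  obtain hi | hi := (k i).eq_zero_or_pos
  · simp [hi]
  · simp [hi, agreeToOrder_sub_one_iff]

end Divisibility

section Space

variable {n : ℕ} {V : Type*} [AddCommGroup V] [Module ℂ V] (b : Module.Basis (Fin n) ℂ V)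

theorem polyEval_mul (p q : MvPolynomial (Fin n) ℂ) (v : V) :
    polyEval b (p * q) v = polyEval b p v * polyEval b q v :=
  map_mul _ p q

theorem polyEval_C_mul (c : ℂ) (p : MvPolynomial (Fin n) ℂ) (v : V) :
    polyEval b (MvPolynomial.C c * p) v = c * polyEval b p v := by
  rw [polyEval_mul, polyEval, MvPolynomial.eval_C]

theorem polyEval_smul (c : ℂ) (p : MvPolynomial (Fin n) ℂ) (v : V) :
    polyEval b (c • p) v = c * polyEval b p v := by
  rw [MvPolynomial.smul_eq_C_mul, polyEval_C_mul]

theorem polyEval_polyComp_sub_smul (p : MvPolynomial (Fin n) ℂ) (T : V →ₗ[ℂ] V) (a : ℂ) (v : V) :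
    polyEval b (polyComp b p T - a • p) v = polyEval b p (T v) - a * polyEval b p v := by
  rw [← polyEval_polyComp, ← polyEval_smul]
  exact map_sub _ _ _

theorem exists_polyEval_eq_eval (x : Fin n → ℂ) :
    ∃ v : V, ∀ p, polyEval b p v = MvPolynomial.eval x p :=
  ⟨b.equivFun.symm x, fun p =>
    congrArg (MvPolynomial.eval · p) (b.equivFun.apply_symm_apply x)⟩

theorem polyEval_injective : Function.Injective (polyEval b) := by
  refine fun p q hpq => MvPolynomial.funext fun x => ?_
  obtain ⟨v, hv⟩ := exists_polyEval_eq_eval b x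
  rw [← hv, ← hv, hpq]

theorem exists_polyEval_ne_zero {p : MvPolynomial (Fin n) ℂ} (hp : p ≠ 0) :
    ∃ v, polyEval b p v ≠ 0 := by
  by_contra! h
  exact hp (polyEval_injective b (funext fun v => (h v).trans (map_zero _).symm))

theorem isTopologicalBasis_polyEval_ne_zero :
    @TopologicalSpace.IsTopologicalBasis V (zariskiSpace b)
      (Set.range fun p => {v | polyEval b p v ≠ 0}) := by
  let _ := zariskiSpace b
  have hgen : zariskiSpace b =
      TopologicalSpace.generateFrom (Set.range fun p => {v | polyEval b p v ≠ 0}) := by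
    rw [zariskiSpace, zariskiTopology]
    congr 1
    ext U
    simp [eq_comm]
  have huniv : Set.univ ∈ Set.range fun p => {v | polyEval b p v ≠ 0} := ⟨1, by simp [polyEval]⟩
  rw [← Set.insert_eq_of_mem huniv]
  refine TopologicalSpace.isTopologicalBasis_of_subbasis_of_inter hgen ?_
  rintro _ ⟨p, rfl⟩ _ ⟨q, rfl⟩
  refine ⟨p * q, ?_⟩
  simp only [polyEval_mul, mul_ne_zero_iff, Set.ofPred_and]

theorem preirreducibleSpace_zariskiSpace : @PreirreducibleSpace V (zariskiSpace b) := by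
  let _ := zariskiSpace b
  have exists_basicOpen_subset {U : Set V} (hU : IsOpen U) (hne : (Set.univ ∩ U).Nonempty) :
      ∃ p, p ≠ 0 ∧ {v | polyEval b p v ≠ 0} ⊆ U := by
    obtain ⟨v, -, hv⟩ := hne
    obtain ⟨_, ⟨p, rfl⟩, hvp, hpU⟩ :=
      (isTopologicalBasis_polyEval_ne_zero b).exists_subset_of_mem_open hv hU
    exact ⟨p, fun hp => hvp (by simp [hp, polyEval]), hpU⟩
  refine ⟨fun U W hU hW hUne hWne => ?_⟩
  obtain ⟨p, hp, hpU⟩ := exists_basicOpen_subset hU hUne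
  obtain ⟨q, hq, hqW⟩ := exists_basicOpen_subset hW hWne
  obtain ⟨v, hv⟩ := exists_polyEval_ne_zero b (mul_ne_zero hp hq)
  rw [polyEval_mul] at hv
  exact ⟨v, trivial, hpU (left_ne_zero_of_mul hv), hqW (right_ne_zero_of_mul hv)⟩

variable {b}

theorem eq_of_polyEval_eqOn {Ω : Set V} (hΩ : @Dense V (zariskiSpace b) Ω)
    {p q : MvPolynomial (Fin n) ℂ} (h : Set.EqOn (polyEval b p) (polyEval b q) Ω) : p = q := by
  let _ := zariskiSpace b
  by_contra hpq
  obtain ⟨v, hv, hvΩ⟩ := hΩ.inter_open_nonempty {v | polyEval b (p - q) v ≠ 0}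
    ((isTopologicalBasis_polyEval_ne_zero b).isOpen ⟨p - q, rfl⟩)
    (exists_polyEval_ne_zero b (sub_ne_zero.2 hpq))
  exact hv ((map_sub _ p q).trans (sub_eq_zero.2 (h hvΩ)))

theorem hasValueAt_ratMk {p q : MvPolynomial (Fin n) ℂ} {v : V} (hq : polyEval b q v ≠ 0) :
    HasValueAt b (ratMk p q) v (polyEval b p v / polyEval b q v) :=
  ⟨p, q, hq, rfl, rfl⟩

theorem hasValueAt_ratMk_one (p : MvPolynomial (Fin n) ℂ) (v : V) :
    HasValueAt b (ratMk p 1) v (polyEval b p v) :=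
  ⟨p, 1, by simp [polyEval], rfl, by simp [polyEval]⟩

theorem isHomogeneous_polyComp_sub_smul {p : MvPolynomial (Fin n) ℂ} {d : ℕ}
    (hp : p.IsHomogeneous d) (T : V →ₗ[ℂ] V) (a : ℂ) :
    (polyComp b p T - a • p).IsHomogeneous d := by
  have hcomp : (polyComp b p T).IsHomogeneous (1 * d) :=
    hp.aeval _ (LinearMap.toMvPolynomial_isHomogeneous b b T)
  rw [one_mul] at hcomp
  exact hcomp.sub ((MvPolynomial.homogeneousSubmodule (Fin n) ℂ d).smul_mem a hp)

theorem zeroSet_subset_of_dvd {p q : MvPolynomial (Fin n) ℂ} (h : p ∣ q) :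
    zeroSet b p ⊆ zeroSet b q := by
  obtain ⟨s, rfl⟩ := h
  intro v (hv : polyEval b p v = 0)
  exact (polyEval_mul b p s v).trans (by rw [hv, zero_mul])

theorem dvd_iff_zeroSet_subset {p q : MvPolynomial (Fin n) ℂ} (hp : Squarefree p) :
    p ∣ q ↔ zeroSet b p ⊆ zeroSet b q := by
  refine ⟨zeroSet_subset_of_dvd, fun h => ?_⟩
  have hq : q ∈ (Ideal.span {p}).radical := by
    rw [← MvPolynomial.vanishingIdeal_zeroLocus_eq_radical (K := ℂ)]
    intro x hx
    obtain ⟨v, hv⟩ := exists_polyEval_eq_eval b x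
    have hpv : polyEval b p v = 0 := (hv p).trans (hx p (Ideal.mem_span_singleton_self p))
    exact (hv q).symm.trans (h hpv)
  obtain ⟨k, hk⟩ := hq
  exact hp.isRadical k q (Ideal.mem_span_singleton.1 hk)

theorem forall_mapsTo_levelSet_iff {F h₁ : MvPolynomial (Fin n) ℂ} {T : V →ₗ[ℂ] V} {a : ℂ}
    (hFT : polyComp b F T = a • F) :
    (∀ ε, Set.MapsTo T (levelSet b F h₁ ε) (levelSet b F h₁ (a * ε))) ↔
      zeroSet b F ⊆ zeroSet b (polyComp b h₁ T - a • h₁) := by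
  simp only [zeroSet, Set.ofPred_subset_ofPred, polyEval_polyComp_sub_smul]
  refine ⟨fun h v hv => (h (polyEval b h₁ v) ⟨hv, sub_self _⟩).2, fun h ε v hv => ⟨?_, ?_⟩⟩
  · rw [← polyEval_polyComp, hFT, polyEval_smul, hv.1, mul_zero]
  · rw [← sub_eq_zero.1 hv.2, h v hv.1]

end Space

theorem forall_image_eq_iff_forall_mapsTo {k G V : Type*} [CommSemiring k] [Group G]
    [AddCommMonoid V] [Module k V] (ρ : Representation k G V) (χ : G →* kˣ) (S : k → Set V) :
    (∀ g ε, ρ g '' S ε = S (χ g * ε)) ↔ ∀ g ε, Set.MapsTo (ρ g) (S ε) (S (χ g * ε)) := by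
  refine ⟨fun h g ε => Set.mapsTo_iff_image_subset.2 (h g ε).subset, fun h g ε =>
    (h g ε).image_subset.antisymm fun v hv => ⟨ρ g⁻¹ v, ?_, ρ.self_inv_apply g v⟩⟩
  simpa using h g⁻¹ _ hv

section Representation

variable {m n : ℕ} {G : Subgroup (GL (Fin m) ℂ)} {V : Type*} [AddCommGroup V] [Module ℂ V]
  {b : Module.Basis (Fin n) ℂ V} {ρ : Representation ℂ G V} {Ω : Set V}

theorem IsRationalRepresentation.isRegular_polyEval (hρ : IsRationalRepresentation ρ)
    (p : MvPolynomial (Fin n) ℂ) (v : V) : IsRegular fun g => polyEval b p (ρ g v) := by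
  induction p using MvPolynomial.induction_on with
  | C c => simpa only [polyEval, MvPolynomial.eval_C] using isRegular_const c
  | add p q hp hq => simpa only [polyEval, map_add] using hp.add hq
  | mul_X p i hp =>
    simpa only [polyEval, map_mul, MvPolynomial.eval_X, b.coord_apply] using
      hp.mul (hρ v (b.coord i))

variable (b ρ Ω) in
/-- `Ω` is a Zariski dense orbit of the representation `ρ`. For an algebraic group acting rationally
this is the same as an open orbit, but density is meaningful for an arbitrary group `G` of matrices
and is the form in which prehomogeneity is used. -/
structure IsDenseOrbit : Prop where
  isOrbit : ∃ v₀ : V, Ω = Set.range fun g : G => ρ g v₀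
  dense : @Dense V (zariskiSpace b) Ω

theorem IsDenseOrbit.nonempty (hΩ : IsDenseOrbit b ρ Ω) : Ω.Nonempty := by
  obtain ⟨v₀, rfl⟩ := hΩ.isOrbit
  exact Set.range_nonempty _

theorem IsDenseOrbit.map_mem (hΩ : IsDenseOrbit b ρ Ω) (g : G) {v : V} (hv : v ∈ Ω) :
    ρ g v ∈ Ω := by
  obtain ⟨v₀, rfl⟩ := hΩ.isOrbit
  obtain ⟨g', rfl⟩ := hv
  exact ⟨g * g', by simp only [map_mul, Module.End.mul_apply]⟩

theorem IsDenseOrbit.exists_map_eq (hΩ : IsDenseOrbit b ρ Ω) {v w : V} (hv : v ∈ Ω) (hw : w ∈ Ω) :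
    ∃ g, ρ g v = w := by
  obtain ⟨v₀, rfl⟩ := hΩ.isOrbit
  obtain ⟨g, rfl⟩ := hv
  obtain ⟨g', rfl⟩ := hw
  exact ⟨g' * g⁻¹, by simp⟩

theorem IsPrehomogeneous.isDenseOrbit (h : IsPrehomogeneous b ρ Ω) :
    IsDenseOrbit b ρ Ω := by
  refine ⟨h.isOrbit, ?_⟩
  let _ := zariskiSpace b
  have := preirreducibleSpace_zariskiSpace b
  obtain ⟨v₀, hv₀⟩ := h.isOrbit
  exact h.isOpen.dense (hv₀ ▸ Set.range_nonempty _)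

theorem AreBasicRelativeInvariants.pairwise_isRelPrime {r : ℕ} {f : Fin r → MvPolynomial (Fin n) ℂ}
    (hf : AreBasicRelativeInvariants b Ω f) : Pairwise (Function.onFun IsRelPrime f) := by
  refine fun i j hij => (hf.irreducible i).isRelPrime_iff_not_dvd.2 fun hdvd => hij ?_
  have hdvd' : f j ∣ f i := (hf.irreducible i).dvd_symm (hf.irreducible j) hdvd
  exact hf.injective ((zeroSet_subset_of_dvd hdvd).antisymm (zeroSet_subset_of_dvd hdvd'))

section SemiInvariant

variable {F h₁ : MvPolynomial (Fin n) ℂ} {X : G →* ℂˣ}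

variable (b ρ F X) in
/-- The polynomial `F` is a semi-invariant of weight `X`, that is, `F ∘ ρ(g) = X(g) F` in `ℂ[V]`:
the global form of the functional equation that a relative invariant satisfies on `Ω`. -/
def IsSemiInvariant : Prop :=
  ∀ g, polyComp b F (ρ g) = (X g : ℂ) • F

theorem IsRelativeInvariantFor.isSemiInvariant (hΩ : IsDenseOrbit b ρ Ω)
    (h : IsRelativeInvariantFor b ρ Ω (ratMk F 1) X) : IsSemiInvariant b ρ F X := by
  refine fun g => eq_of_polyEval_eqOn hΩ.dense fun v hv => ?_
  obtain ⟨c, hc, hc'⟩ := h.equation g v hv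
  rw [polyEval_polyComp, polyEval_smul, (hasValueAt_ratMk_one F (ρ g v)).unique hc',
    (hasValueAt_ratMk_one F v).unique hc]

theorem IsRelativeInvariantFor.polynomial_ne_zero
    (h : IsRelativeInvariantFor b ρ Ω (ratMk F 1) X) : F ≠ 0 := by
  rintro rfl
  exact h.ne_zero (by rw [ratMk, map_zero, zero_div])

theorem isSemiInvariant_prod_pow {ι : Type*} (s : Finset ι) {f : ι → MvPolynomial (Fin n) ℂ}
    {χ : ι → G →* ℂˣ} (h : ∀ i ∈ s, IsSemiInvariant b ρ (f i) (χ i)) (k : ι → ℕ) :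
    IsSemiInvariant b ρ (∏ i ∈ s, f i ^ k i) (∏ i ∈ s, χ i ^ k i) := by
  intro g
  have hpow : ∀ i ∈ s, polyComp b (f i) (ρ g) ^ k i =
      MvPolynomial.C (χ i g : ℂ) ^ k i * f i ^ k i := fun i hi => by
    rw [h i hi g, MvPolynomial.smul_eq_C_mul, mul_pow]
  simp only [polyComp, MvPolynomial.smul_eq_C_mul] at hpow ⊢
  simp [Finset.prod_congr rfl hpow, Finset.prod_mul_distrib]

theorem IsSemiInvariant.polyEval_map (hF : IsSemiInvariant b ρ F X) (g : G) (v : V) :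
    polyEval b F (ρ g v) = X g * polyEval b F v := by
  rw [← polyEval_polyComp, hF g, polyEval_smul]

theorem IsSemiInvariant.polyEval_ne_zero (hF : IsSemiInvariant b ρ F X)
    (hΩ : IsDenseOrbit b ρ Ω) (hF0 : F ≠ 0) {v : V} (hv : v ∈ Ω) : polyEval b F v ≠ 0 := by
  refine fun hFv => hF0 (eq_of_polyEval_eqOn hΩ.dense fun w hw => ?_)
  obtain ⟨g, rfl⟩ := hΩ.exists_map_eq hv hw
  rw [hF.polyEval_map, hFv, mul_zero]
  exact (map_zero _).symm

theorem IsSemiInvariant.isRationalCharacter (hF : IsSemiInvariant b ρ F X)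
    (hρ : IsRationalRepresentation ρ) (hF0 : F ≠ 0) : IsRationalCharacter X := by
  obtain ⟨v, hv⟩ := exists_polyEval_ne_zero b hF0
  simpa only [hF.polyEval_map, mul_inv_cancel_right₀ hv, IsRationalCharacter] using
    (hρ.isRegular_polyEval (b := b) F v).mul (isRegular_const (polyEval b F v)⁻¹)

theorem IsSemiInvariant.div_map_sub_div (hF : IsSemiInvariant b ρ F X) (g : G) (v : V) :
    polyEval b h₁ (ρ g v) / polyEval b F (ρ g v) - polyEval b h₁ v / polyEval b F v =
      polyEval b (polyComp b h₁ (ρ g) - (X g : ℂ) • h₁) v / (X g * polyEval b F v) := by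
  rw [hF.polyEval_map, polyEval_polyComp_sub_smul, sub_div, mul_div_mul_left _ _ (X g).ne_zero]

theorem IsSemiInvariant.isAdditiveFunction_of_div_map_sub_div (hF : IsSemiInvariant b ρ F X)
    (hρ : IsRationalRepresentation ρ) (hΩ : IsDenseOrbit b ρ Ω) (hF0 : F ≠ 0) {Φ : G → ℂ}
    (hΦ : ∀ g, ∀ v ∈ Ω, polyEval b h₁ (ρ g v) / polyEval b F (ρ g v) -
      polyEval b h₁ v / polyEval b F v = Φ g) : IsAdditiveFunction Φ := by
  obtain ⟨v₀, hv₀⟩ := hΩ.nonempty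
  refine ⟨fun g g' => ?_, ?_⟩
  · rw [← hΦ (g * g') v₀ hv₀, ← hΦ g (ρ g' v₀) (hΩ.map_mem g' hv₀), ← hΦ g' v₀ hv₀, map_mul,
      Module.End.mul_apply, sub_add_sub_cancel]
  · have hΦ_eq : Φ = fun g => polyEval b h₁ (ρ g v₀) * ((X g : ℂ)⁻¹ * (polyEval b F v₀)⁻¹) -
        polyEval b h₁ v₀ / polyEval b F v₀ := by
      funext g
      rw [← hΦ g v₀ hv₀, hF.polyEval_map, div_eq_mul_inv _ (_ * _), mul_inv]
    have hXinv := (hF.isRationalCharacter hρ hF0).isRegular_inv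
    exact hΦ_eq ▸ ((hρ.isRegular_polyEval h₁ v₀).mul (hXinv.mul (isRegular_const _))).sub
      (isRegular_const _)

theorem IsSemiInvariant.isAdditiveRelativeInvariant_ratMk_iff (hF : IsSemiInvariant b ρ F X)
    (hρ : IsRationalRepresentation ρ) (hΩ : IsDenseOrbit b ρ Ω) (hF0 : F ≠ 0) :
    IsAdditiveRelativeInvariant b ρ Ω (ratMk h₁ F) ↔
      ∀ g, ∃ c, polyComp b h₁ (ρ g) - (X g : ℂ) • h₁ = MvPolynomial.C c * F := by
  have hFΩ : ∀ v ∈ Ω, polyEval b F v ≠ 0 := fun _ => hF.polyEval_ne_zero hΩ hF0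
  have value {v : V} (hv : v ∈ Ω) := hasValueAt_ratMk (p := h₁) (hFΩ v hv)
  constructor
  · rintro ⟨Φ, -, hΦ⟩ g
    refine ⟨Φ g * X g, eq_of_polyEval_eqOn hΩ.dense fun v hv => ?_⟩
    obtain ⟨a, c, ha, hc, hac⟩ := hΦ g v hv
    rw [ha.unique (value (hΩ.map_mem g hv)), hc.unique (value hv), hF.div_map_sub_div g v,
      div_eq_iff (mul_ne_zero (X g).ne_zero (hFΩ v hv))] at hac
    rw [hac, polyEval_C_mul, mul_assoc]
  · intro h
    choose c hc using h
    have hΦ (g : G) (v : V) (hv : v ∈ Ω) : polyEval b h₁ (ρ g v) / polyEval b F (ρ g v) -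
        polyEval b h₁ v / polyEval b F v = c g / X g := by
      rw [hF.div_map_sub_div g v, hc, polyEval_C_mul, mul_div_mul_right _ _ (hFΩ v hv)]
    exact ⟨fun g => c g / X g, hF.isAdditiveFunction_of_div_map_sub_div hρ hΩ hF0 hΦ, fun g v hv =>
      ⟨_, _, value (hΩ.map_mem g hv), value hv, hΦ g v hv⟩⟩

theorem IsSemiInvariant.forall_image_levelSet_eq_iff (hF : IsSemiInvariant b ρ F X)
    (hsq : Squarefree F) :
    (∀ (g : G) (ε : ℂ), ρ g '' levelSet b F h₁ ε = levelSet b F h₁ ((X g : ℂ) * ε)) ↔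
      ∀ g, F ∣ polyComp b h₁ (ρ g) - (X g : ℂ) • h₁ := by
  rw [forall_image_eq_iff_forall_mapsTo]
  exact forall_congr' fun g =>
    (forall_mapsTo_levelSet_iff (hF g)).trans (dvd_iff_zeroSet_subset hsq).symm

end SemiInvariant

end Representation

end PVS

theorem mainTheorem7_general {m n : ℕ} {ι V : Type*} [Fintype ι] [AddCommGroup V] [Module ℂ V]
    (b : Module.Basis (Fin n) ℂ V)
    (G : Subgroup (GL (Fin m) ℂ)) (ρ : Representation ℂ G V) (Ω : Set V)
    (hρ : PVS.IsRationalRepresentation ρ) (hΩ : PVS.IsDenseOrbit b ρ Ω)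
    (f : ι → MvPolynomial (Fin n) ℂ) (hf : Pairwise (Function.onFun IsRelPrime f))
    (χ : ι → (G →* ℂˣ))
    (hχ : ∀ i, PVS.IsRelativeInvariantFor b ρ Ω (PVS.ratMk (f i) 1) (χ i))
    (k : ι → ℕ) (h₁ F : MvPolynomial (Fin n) ℂ) (d : ℕ)
    (hF : F = ∏ i, f i ^ k i)
    (hh₁d : h₁.IsHomogeneous d) (hFd : F.IsHomogeneous d)
    (X : G →* ℂˣ) (hX : X = ∏ i, χ i ^ k i) :
    List.TFAE
      [PVS.IsAdditiveRelativeInvariant b ρ Ω (PVS.ratMk h₁ F),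
        ∀ i, 0 < k i → ∀ g : G,
          PVS.AgreeToOrder (k i - 1) (f i) (PVS.polyComp b h₁ (ρ g)) ((X g : ℂ) • h₁),
        ∀ g : G, F ∣ PVS.polyComp b h₁ (ρ g) - (X g : ℂ) • h₁] ∧
    (Squarefree F →
      (PVS.IsAdditiveRelativeInvariant b ρ Ω (PVS.ratMk h₁ F) ↔
        ∀ (g : G) (ε : ℂ),
          ρ g '' PVS.levelSet b F h₁ ε = PVS.levelSet b F h₁ ((X g : ℂ) * ε))) := by
  have hF0 : F ≠ 0 :=
    hF ▸ Finset.prod_ne_zero_iff.2 fun i _ => pow_ne_zero _ (hχ i).polynomial_ne_zero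
  have hFX : PVS.IsSemiInvariant b ρ F X :=
    hF ▸ hX ▸ PVS.isSemiInvariant_prod_pow _ (fun i _ => (hχ i).isSemiInvariant hΩ) k
  have additive_iff_dvd : PVS.IsAdditiveRelativeInvariant b ρ Ω (PVS.ratMk h₁ F) ↔
      ∀ g : G, F ∣ PVS.polyComp b h₁ (ρ g) - (X g : ℂ) • h₁ :=
    (hFX.isAdditiveRelativeInvariant_ratMk_iff hρ hΩ hF0).trans <| forall_congr' fun g =>
      (PVS.dvd_iff_exists_eq_C_mul hFd (PVS.isHomogeneous_polyComp_sub_smul hh₁d _ _)).symm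
  have agree_iff_dvd : (∀ i, 0 < k i → ∀ g : G,
      PVS.AgreeToOrder (k i - 1) (f i) (PVS.polyComp b h₁ (ρ g)) ((X g : ℂ) • h₁)) ↔
        ∀ g : G, F ∣ PVS.polyComp b h₁ (ρ g) - (X g : ℂ) • h₁ := by
    simp only [hF, ← PVS.forall_agreeToOrder_sub_one_iff hf k]
    exact ⟨fun h g i hi => h i hi g, fun h i hi g => h g i hi⟩
  refine ⟨?_, fun hsq => additive_iff_dvd.trans (hFX.forall_image_levelSet_eq_iff hsq).symm⟩
  tfae_have 1 ↔ 3 := additive_iff_dvd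
  tfae_have 2 ↔ 3 := agree_iff_dvd
  tfae_finish

theorem mainTheorem7 {m n r : ℕ} {V : Type*} [AddCommGroup V] [Module ℂ V]
    (b : Module.Basis (Fin n) ℂ V)
    (G : Subgroup (GL (Fin m) ℂ)) (ρ : Representation ℂ G V) (Ω : Set V)
    (hρ : PVS.IsPrehomogeneous b ρ Ω)
    (f : Fin r → MvPolynomial (Fin n) ℂ) (hf : PVS.AreBasicRelativeInvariants b Ω f)
    (χ : Fin r → (G →* ℂˣ))
    (hχ : ∀ i, PVS.IsRelativeInvariantFor b ρ Ω (PVS.ratMk (f i) 1) (χ i))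
    (k : Fin r → ℕ) (h₁ F : MvPolynomial (Fin n) ℂ) (d : ℕ)
    (hF : F = ∏ i, f i ^ k i)
    (hh₁d : h₁.IsHomogeneous d) (hFd : F.IsHomogeneous d)
    (hlow : IsRelPrime h₁ F)
    (X : G →* ℂˣ) (hX : X = ∏ i, χ i ^ k i) :
    List.TFAE
      [PVS.IsAdditiveRelativeInvariant b ρ Ω (PVS.ratMk h₁ F),
        ∀ i, 0 < k i → ∀ g : G,
          PVS.AgreeToOrder (k i - 1) (f i) (PVS.polyComp b h₁ (ρ g)) ((X g : ℂ) • h₁),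
        ∀ g : G, F ∣ PVS.polyComp b h₁ (ρ g) - (X g : ℂ) • h₁] ∧
    (Squarefree F →
      (PVS.IsAdditiveRelativeInvariant b ρ Ω (PVS.ratMk h₁ F) ↔
        ∀ (g : G) (ε : ℂ),
          ρ g '' PVS.levelSet b F h₁ ε = PVS.levelSet b F h₁ ((X g : ℂ) * ε))) :=
  mainTheorem7_general b G ρ Ω hρ.rational hρ.isDenseOrbit f hf.pairwise_isRelPrime χ hχ k h₁ F d hF
    hh₁d hFd X hX
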